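/- Let $(T_n)_{n\ge 1}$ be a uniform random recursive tree: $T_1$ is the single vertex $1$ (the root), and for every $n\ge 1$ the tree $T_{n+1}$ on the vertex set $[n+1]=\{1,\dots,n+1\}$ is obtained from $T_n$ by adding the vertex $n+1$ together with an edge joining it to a vertex chosen uniformly at random from $[n]$, independently of the previous choices. For a finite tree $T$ and vertices $u,v$ of $T$, let $(T,v)_{u\downarrow}$ be the set of vertices $w$ such that the path from $w$ to $v$ contains $u$, and let $$\varphi_{T}(v)=\prod_{u\in V(T)\setminus\{v\}}\bigl|(T,v)_{u\downarrow}\bigr|$$ be the rumor centrality of $v$; smaller values mean more central. Rank the vertices of $T_n$ from most to least central, breaking ties by placing the vertex with the larger label first. The rank of the root is thus $$R_n=1+\#\{v\in[n]\setminus\{1\}:\ \varphi_{T_n}(v)\le\varphi_{T_n}(1)\}.$$ Then $R_n$ is persistent: there exist random variables $N,K$ with values in $\mathbb{N}\cup\{\infty\}$, both almost surely finite, such that $R_n=K$ for all $n\ge N$. -/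

import Mathlib

open MeasureTheory ProbabilityTheory
open scoped ENNReal

namespace RumorRank

section Trees

variable {V : Type*}

/-- `(T, v)_{u↓}`: the vertex set of the subtree hanging from `u` when the tree `T` is rooted
at `v`, that is, all `w` such that the path from `w` to `v` contains `u`. -/
def subtree (T : SimpleGraph V) (v u : V) : Set V :=
  {w | ∃ p : T.Walk w v, p.IsPath ∧ u ∈ p.support}

/-- Rumor centrality `φ_T(v) = ∏_{u ≠ v} |(T, v)_{u↓}|`; smaller values are more central. -/
noncomputable def rumorCentrality [Fintype V] [DecidableEq V] (T : SimpleGraph V) (v : V) : ℕ :=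
  ∏ u ∈ Finset.univ.erase v, (subtree T v u).ncard

/-- The rank `γ(u) = 1 + #{v : v is ranked before u}` for a centrality measure `ψ` for which
smaller values are more central, with pessimistic tie-breaking: among vertices of equal
centrality the one with the larger label is ranked first. -/
noncomputable def rank [LinearOrder V] (ψ : V → ℕ) (u : V) : ℕ :=
  1 + {v : V | ψ v < ψ u ∨ (ψ v = ψ u ∧ u < v)}.ncard

end Trees

/-- The increasing trees grown from a sequence of attachments. The tree of index `n` has the
`n + 1` vertices `0, …, n` (so label `i` here is label `i + 1` when labels start at `1`);
it starts from the single root `0`, and the tree of index `n + 1` arises from that of index `n`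
by adding the new vertex `n + 1` and joining it by an edge to the old vertex `a n`. -/
def recursiveTree (a : ∀ n : ℕ, Fin (n + 1)) : ∀ n : ℕ, SimpleGraph (Fin (n + 1))
  | 0 => ⊥
  | n + 1 =>
    (recursiveTree a n).map Fin.castSuccEmb ⊔
      SimpleGraph.edge (Fin.castSucc (a n)) (Fin.last (n + 1))

/-- The attachments of a uniform random recursive tree: independent choices, the choice made
when `n + 1` vertices are present being uniform on these `n + 1` vertices. -/
structure IsUniformAttachment {Ω : Type*} [MeasurableSpace Ω] (μ : Measure Ω)
    (U : ∀ n : ℕ, Ω → Fin (n + 1)) : Prop where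
  measurable : ∀ n, Measurable (U n)
  indep : iIndepFun U μ
  uniform : ∀ (n : ℕ) (i : Fin (n + 1)), μ {ω | U n ω = i} = ((n + 1 : ℕ) : ℝ≥0∞)⁻¹

/-- The rumor-centrality rank of the root `0` in the tree of index `n`
(the tree with `n + 1` vertices). -/
noncomputable def rootRank {Ω : Type*} (U : ∀ n : ℕ, Ω → Fin (n + 1)) (n : ℕ) (ω : Ω) : ℕ :=
  rank (rumorCentrality (recursiveTree (fun k => U k ω) n)) 0

/-- A sequence of integer-valued random variables is persistent if there are almost surely
finite random variables `N`, `K` such that `R n = K` for all `n ≥ N`. -/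
def Persistent {Ω : Type*} [MeasurableSpace Ω] (μ : Measure Ω) (R : ℕ → Ω → ℕ) : Prop :=
  ∃ N K : Ω → ℕ∞, Measurable N ∧ Measurable K ∧
    μ {ω | N ω < ⊤} = 1 ∧ μ {ω | K ω < ⊤} = 1 ∧
    ∀ ω, ∀ n : ℕ, N ω ≤ (n : ℕ∞) → (R n ω : ℕ∞) = K ω

end RumorRank

/-! Let `s_c` be the number of descendants of `c` among the `n + 1` vertices present. Moving the
viewpoint across one edge changes only two factors of the rumor centrality, so the centrality of `v`
divided by that of the root is the product of `(n + 1 - s_c) / s_c` over the non-root vertices `c`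
on the path to `v` (`rumorCentrality_mul_prod`). The rank of the root thus counts the `v` with
`pathGap a v n ≤ 0`.

Each `s_c` evolves as a Pólya urn. Explicit martingales show that its proportion tends to a limit
strictly between `0` and `1` (`ae_hasProperLimits`); a maximal inequality with Borel–Cantelli shows
that late vertices have uniformly small proportions (`ae_frac_small`). Hence only finitely many `v`
can compete with the root, and the rank stabilises once each of their gaps has a nonzero limit
(`HasProperLimits.eventually_rank_eq`).

The limit is almost surely nonzero (`ae_not_tendsto_pathGap`): redirecting vertex `n + 1` from
outside the descendants of `v` to inside strictly lowers it, so with the other attachments fixed a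
zero limit can occur only for attachments inside, or only for attachments outside. Its conditional
probability given the first `n` attachments therefore stays away from `1`, while by Lévy's theorem
it tends to the indicator of the event. -/

namespace RumorRank

/-! ### Ancestors and descendant counts -/

/-- A sequence of attachments; vertex `n + 1` is joined to `a n`. -/
abbrev Attachment : Type := ∀ n : ℕ, Fin (n + 1)

/-- The vertices on the path from `w` to the root `0`, including `w` and `0`. -/
def ancestors (a : Attachment) : ℕ → Finset ℕ
  | 0 => {0}
  | k + 1 => insert (k + 1) (ancestors a (a k))
termination_by w => w
decreasing_by exact (a k).isLt

section Ancestors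

variable {a b : Attachment}

lemma ancestors_zero : ancestors a 0 = {0} := by rw [ancestors]

lemma ancestors_succ (k : ℕ) :
    ancestors a (k + 1) = insert (k + 1) (ancestors a (a k)) := by rw [ancestors]

/-- Induction along the path to the root. -/
lemma parent_induction (a : Attachment) {p : ℕ → Prop} (zero : p 0)
    (succ : ∀ k, p (a k) → p (k + 1)) (w : ℕ) : p w := by
  induction w using Nat.strong_induction_on with
  | _ w ih =>
    cases w with
    | zero => exact zero
    | succ k => exact succ k (ih _ (a k).isLt)

lemma self_mem_ancestors (w : ℕ) : w ∈ ancestors a w := by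
  cases w <;> simp [ancestors_zero, ancestors_succ]

lemma zero_mem_ancestors (w : ℕ) : 0 ∈ ancestors a w := by
  induction w using parent_induction a with
  | zero => exact self_mem_ancestors 0
  | succ k ih => simp [ancestors_succ, ih]

lemma le_of_mem_ancestors {u w : ℕ} (h : u ∈ ancestors a w) : u ≤ w := by
  induction w using parent_induction a with
  | zero => simpa [ancestors_zero] using h
  | succ k ih =>
    rw [ancestors_succ, Finset.mem_insert] at h
    rcases h with rfl | h
    · exact le_rfl
    · exact (ih h).trans (a k).isLt.le

lemma mem_ancestors_succ_iff {u k : ℕ} (h : u ≠ k + 1) :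
    u ∈ ancestors a (k + 1) ↔ u ∈ ancestors a (a k) := by
  simp [ancestors_succ, h]

lemma ancestors_trans {u v w : ℕ} (huv : u ∈ ancestors a v) (hvw : v ∈ ancestors a w) :
    u ∈ ancestors a w := by
  induction w using parent_induction a with
  | zero =>
    rw [ancestors_zero, Finset.mem_singleton] at hvw
    exact hvw ▸ huv
  | succ k ih =>
    rw [ancestors_succ, Finset.mem_insert] at hvw
    rcases hvw with rfl | h
    · exact huv
    · rw [ancestors_succ]
      exact Finset.mem_insert_of_mem (ih h)

lemma succ_notMem_ancestors_parent (k : ℕ) : k + 1 ∉ ancestors a (a k) := fun h =>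
  absurd (le_of_mem_ancestors h) (not_le.2 (a k).isLt)

lemma ancestors_congr {n w : ℕ} (h : ∀ k < n, a k = b k) (hw : w ≤ n) :
    ancestors a w = ancestors b w := by
  induction w using parent_induction a with
  | zero => rw [ancestors_zero, ancestors_zero]
  | succ k ih => rw [ancestors_succ, ancestors_succ, ih ((a k).is_le.trans (by omega)), h k hw]

end Ancestors

/-- The number of descendants of `u`, including `u`, among the vertices `0, …, n`. -/
def size (a : Attachment) (u n : ℕ) : ℕ :=
  ((Finset.range (n + 1)).filter fun w => u ∈ ancestors a w).card

/-- The path from the root to `v`, without the root. -/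
def rootPath (a : Attachment) (v : ℕ) : Finset ℕ := (ancestors a v).erase 0

/-! ### Rumor centrality in terms of descendant counts -/

section Graph

variable (a : Attachment)

lemma recursiveTree_adj {n : ℕ} {x y : Fin (n + 1)} :
    (recursiveTree a n).Adj x y ↔
      (∃ k, x.val = k + 1 ∧ y.val = a k) ∨ ∃ k, y.val = k + 1 ∧ x.val = a k := by
  induction n with
  | zero =>
    have hx := x.isLt
    have hy := y.isLt
    simp only [recursiveTree, SimpleGraph.bot_adj, false_iff]
    rintro (⟨k, h, -⟩ | ⟨k, h, -⟩) <;> omega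
  | succ n ih =>
    rw [recursiveTree, SimpleGraph.sup_adj, SimpleGraph.edge_adj]
    constructor
    · rintro (h | ⟨⟨rfl, rfl⟩ | ⟨rfl, rfl⟩, -⟩)
      · obtain ⟨x', y', h', rfl, rfl⟩ := (SimpleGraph.map_adj ..).1 h
        simpa using ih.1 h'
      · exact Or.inr ⟨n, by simp⟩
      · exact Or.inl ⟨n, by simp⟩
    · have key : ∀ x y : Fin (n + 1 + 1), (∃ k, x.val = k + 1 ∧ y.val = a k) →
          ((recursiveTree a n).map Fin.castSuccEmb).Adj x y ∨
            x = Fin.last (n + 1) ∧ y = Fin.castSucc (a n) := by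
        rintro x y ⟨k, hx, hy⟩
        by_cases hk : k = n
        · subst hk
          exact Or.inr ⟨Fin.ext (by simpa using hx), Fin.ext (by simpa using hy)⟩
        · have hk' : k < n := by have := x.isLt; omega
          have hak := (a k).isLt
          refine Or.inl ((SimpleGraph.map_adj ..).2 ⟨⟨x, by omega⟩, ⟨y, by omega⟩, ?_,
            Fin.ext (by simp), Fin.ext (by simp)⟩)
          exact ih.2 (Or.inl ⟨k, hx, hy⟩)
      rintro (h | h)
      · rcases key x y h with h' | ⟨rfl, rfl⟩
        · exact Or.inl h'
        · exact Or.inr ⟨Or.inr ⟨rfl, rfl⟩, (Fin.castSucc_lt_last _).ne'⟩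
      · rcases key y x h with h' | ⟨rfl, rfl⟩
        · exact Or.inl h'.symm
        · exact Or.inr ⟨Or.inl ⟨rfl, rfl⟩, (Fin.castSucc_lt_last _).ne⟩

/-- The only edge leaving the set of descendants of `k + 1` joins `k + 1` to its parent. -/
lemma eq_of_adj_of_mem_of_notMem {n k : ℕ} {x y : Fin (n + 1)} (h : (recursiveTree a n).Adj x y)
    (hx : k + 1 ∈ ancestors a x) (hy : k + 1 ∉ ancestors a y) : x.val = k + 1 ∧ y.val = a k := by
  rcases (recursiveTree_adj a).1 h with ⟨j, hj, hj'⟩ | ⟨j, hj, hj'⟩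
  · rw [hj, ancestors_succ, Finset.mem_insert, ← hj'] at hx
    obtain hx := hx.resolve_right hy
    obtain rfl : k = j := by omega
    exact ⟨hj, hj'⟩
  · rw [hj, ancestors_succ, Finset.mem_insert, not_or, ← hj'] at hy
    exact absurd hx hy.2

/-- Every edge is a bridge: it is the only edge leaving the descendant set of its child end. -/
lemma recursiveTree_isAcyclic (n : ℕ) : (recursiveTree a n).IsAcyclic := by
  rw [SimpleGraph.isAcyclic_iff_forall_isBridge]
  have key : ∀ (k : ℕ) (x y : Fin (n + 1)), x.val = k + 1 → y.val = a k →
      ¬ ((recursiveTree a n).deleteEdges {s(x, y)}).Reachable x y := by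
    rintro k x y hx hy ⟨p⟩
    obtain ⟨d, -, h1, h2⟩ := p.exists_boundary_dart {z | k + 1 ∈ ancestors a z}
      (by simp only [Set.mem_ofPred_eq, hx, self_mem_ancestors])
      (by simpa only [Set.mem_ofPred_eq, hy] using succ_notMem_ancestors_parent k)
    have hd := d.adj
    rw [SimpleGraph.deleteEdges_adj] at hd
    obtain ⟨h3, h4⟩ := eq_of_adj_of_mem_of_notMem a hd.1 h1 h2
    apply hd.2
    rw [Fin.ext (h3.trans hx.symm), Fin.ext (h4.trans hy.symm)]
    exact rfl
  intro e
  induction e using Sym2.ind with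
  | _ x y =>
    intro he
    rw [SimpleGraph.mem_edgeSet] at he
    rw [SimpleGraph.isBridge_iff]
    rcases (recursiveTree_adj a).1 he with ⟨k, hx, hy⟩ | ⟨k, hx, hy⟩
    · exact key k x y hx hy
    · intro h
      rw [Sym2.eq_swap] at h
      exact key k y x hx hy h.symm

lemma exists_walk_to_root {n : ℕ} (u w : Fin (n + 1)) (h : u.val ∉ ancestors a w) :
    ∃ p : (recursiveTree a n).Walk w 0, u ∉ p.support := by
  obtain ⟨w, hw⟩ := w
  induction w using parent_induction a with
  | zero =>
    change ∃ p : (recursiveTree a n).Walk 0 0, u ∉ p.support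
    refine ⟨SimpleGraph.Walk.nil, ?_⟩
    intro hu
    rw [SimpleGraph.Walk.support_nil, List.mem_singleton] at hu
    exact h (by rw [hu]; exact self_mem_ancestors 0)
  | succ k ih =>
    simp only [ancestors_succ, Finset.mem_insert, not_or] at h
    have hk := (a k).isLt
    obtain ⟨p, hp⟩ := ih (by omega) h.2
    refine ⟨SimpleGraph.Walk.cons ((recursiveTree_adj a).2 (Or.inl ⟨k, rfl, rfl⟩)) p, ?_⟩
    rw [SimpleGraph.Walk.support_cons, List.mem_cons, not_or]
    exact ⟨fun hu => h.1 (by rw [hu]), hp⟩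

lemma exists_walk_to_ancestor {n : ℕ} (u c w : Fin (n + 1)) (h : c.val ∈ ancestors a w)
    (hu : c.val ∉ ancestors a u) : ∃ p : (recursiveTree a n).Walk w c, u ∉ p.support := by
  obtain ⟨w, hw⟩ := w
  induction w using parent_induction a with
  | zero =>
    rw [ancestors_zero, Finset.mem_singleton] at h
    exact absurd (h ▸ zero_mem_ancestors _) hu
  | succ k ih =>
    have hne : u ≠ ⟨k + 1, hw⟩ := by
      rintro rfl
      exact hu h
    by_cases hck : c.val = k + 1
    · obtain rfl : c = ⟨k + 1, hw⟩ := Fin.ext hck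
      exact ⟨SimpleGraph.Walk.nil, by simpa using hne⟩
    · have hk := (a k).isLt
      obtain ⟨p, hp⟩ := ih (by omega) ((mem_ancestors_succ_iff hck).1 h)
      refine ⟨SimpleGraph.Walk.cons ((recursiveTree_adj a).2 (Or.inl ⟨k, rfl, rfl⟩)) p, ?_⟩
      rw [SimpleGraph.Walk.support_cons, List.mem_cons, not_or]
      exact ⟨hne, hp⟩

lemma recursiveTree_reachable {n : ℕ} (x y : Fin (n + 1)) : (recursiveTree a n).Reachable x y := by
  have key : ∀ x : Fin (n + 1), (recursiveTree a n).Reachable x 0 := by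
    rintro ⟨w, hw⟩
    induction w using parent_induction a with
    | zero => exact SimpleGraph.Reachable.refl _
    | succ k ih =>
      have hk := (a k).isLt
      have hadj : (recursiveTree a n).Adj ⟨k + 1, hw⟩ ⟨a k, by omega⟩ :=
        (recursiveTree_adj a).2 (Or.inl ⟨k, rfl, rfl⟩)
      exact hadj.reachable.trans (ih (by omega))
  exact (key x).trans (key y).symm

/-- Paths are unique in a tree, and every walk contains one. With all walks allowed, non-membership
needs just one avoiding walk, not necessarily a path. -/
lemma mem_subtree_iff {n : ℕ} {v u w : Fin (n + 1)} :
    w ∈ subtree (recursiveTree a n) v u ↔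
      ∀ p : (recursiveTree a n).Walk w v, u ∈ p.support := by
  classical
  constructor
  · rintro ⟨p, hp, hu⟩ q
    have := (recursiveTree_isAcyclic a n).subsingleton_path w v
    have heq : (⟨p, hp⟩ : (recursiveTree a n).Path w v) = q.toPath := Subsingleton.elim _ _
    have hpq : p = q.bypass := congrArg Subtype.val heq
    exact q.support_bypass_subset_support (hpq ▸ hu)
  · intro h
    obtain ⟨p⟩ := recursiveTree_reachable a w v
    exact ⟨p.bypass, p.bypass_isPath, h _⟩

lemma self_mem_subtree {n : ℕ} (v u : Fin (n + 1)) : u ∈ subtree (recursiveTree a n) v u :=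
  (mem_subtree_iff a).2 fun p => p.start_mem_support

lemma rumorCentrality_pos (n : ℕ) (v : Fin (n + 1)) :
    0 < rumorCentrality (recursiveTree a n) v :=
  Finset.prod_pos fun u _ => (Set.ncard_pos (Set.toFinite _)).2 ⟨u, self_mem_subtree a v u⟩

section Edge

variable {n k : ℕ} {c p : Fin (n + 1)} (hc : c.val = k + 1) (hp : p.val = a k)
include hc hp

lemma subtree_parent_child :
    subtree (recursiveTree a n) p c = {w : Fin (n + 1) | c.val ∈ ancestors a w} := by
  have hcp : c.val ∉ ancestors a p := by
    rw [hc, hp]; exact succ_notMem_ancestors_parent k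
  ext w
  rw [mem_subtree_iff, Set.mem_ofPred_eq]
  constructor
  · intro h
    by_contra hw
    obtain ⟨q, hq⟩ := exists_walk_to_root a c w hw
    obtain ⟨r, hr⟩ := exists_walk_to_root a c p hcp
    have := h (q.append r.reverse)
    rw [SimpleGraph.Walk.mem_support_append_iff, SimpleGraph.Walk.support_reverse,
      List.mem_reverse] at this
    exact this.elim hq hr
  · intro hw q
    obtain ⟨d, hd, h1, h2⟩ := q.exists_boundary_dart {z | k + 1 ∈ ancestors a z}
      (by rw [← hc]; exact hw) (by rw [← hc]; exact hcp)
    have := (eq_of_adj_of_mem_of_notMem a d.adj h1 h2).1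
    rw [← (Fin.ext (this.trans hc.symm) : d.fst = c)]
    exact q.dart_fst_mem_support_of_mem_darts hd

lemma subtree_child_parent :
    subtree (recursiveTree a n) c p = {w : Fin (n + 1) | c.val ∈ ancestors a w}ᶜ := by
  have hcp : c.val ∉ ancestors a p := by
    rw [hc, hp]; exact succ_notMem_ancestors_parent k
  ext w
  rw [mem_subtree_iff, Set.mem_compl_iff, Set.mem_ofPred_eq]
  constructor
  · intro h hw
    obtain ⟨q, hq⟩ := exists_walk_to_ancestor a p c w hw hcp
    exact hq (h q)
  · intro hw q
    obtain ⟨d, hd, h1, h2⟩ := q.exists_boundary_dart {z | k + 1 ∈ ancestors a z}ᶜ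
      (by rw [← hc]; exact hw) (by
        rw [Set.notMem_compl_iff, ← hc]; exact self_mem_ancestors _)
    rw [Set.notMem_compl_iff] at h2
    have := (eq_of_adj_of_mem_of_notMem a d.adj.symm h2 h1).2
    rw [← (Fin.ext (this.trans hp.symm) : d.fst = p)]
    exact q.dart_fst_mem_support_of_mem_darts hd

/-- A walk to one end of the edge extends to the other end, and the added vertex is not `u`. -/
lemma subtree_child_eq_subtree_parent {u : Fin (n + 1)} (huc : u ≠ c) (hup : u ≠ p) :
    subtree (recursiveTree a n) c u = subtree (recursiveTree a n) p u := by
  have hadj : (recursiveTree a n).Adj c p := (recursiveTree_adj a).2 (Or.inl ⟨k, hc, hp⟩)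
  ext w
  rw [mem_subtree_iff, mem_subtree_iff]
  constructor
  · intro h q
    have := h (q.concat hadj.symm)
    rw [SimpleGraph.Walk.support_concat] at this
    simpa [huc] using this
  · intro h q
    have := h (q.concat hadj)
    rw [SimpleGraph.Walk.support_concat] at this
    simpa [hup] using this

end Edge

lemma ncard_descendants (c n : ℕ) :
    {w : Fin (n + 1) | c ∈ ancestors a w}.ncard = size a c n := by
  rw [size, Set.ncard_eq_toFinset_card']
  refine Finset.card_bij (fun w _ => w.val) ?_ ?_ ?_
  · intro w hw
    simp only [Set.mem_toFinset, Set.mem_ofPred_eq] at hw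
    simpa [hw] using w.is_le
  · intro w _ w' _ h
    exact Fin.ext h
  · intro w hw
    rw [Finset.mem_filter, Finset.mem_range] at hw
    exact ⟨⟨w, hw.1⟩, by simpa using hw.2, rfl⟩

lemma size_le (u n : ℕ) : size a u n ≤ n + 1 :=
  (Finset.card_filter_le _ _).trans (Finset.card_range _).le

/-- Only the factors of `c` and `p` differ: seen from `p` the subtree of `c` is its descendant set,
and seen from `c` the subtree of `p` is the complement. Multiplying out avoids division in `ℕ`. -/
lemma rumorCentrality_child {n k : ℕ} {c p : Fin (n + 1)} (hc : c.val = k + 1) (hp : p.val = a k) :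
    rumorCentrality (recursiveTree a n) c * size a c n =
      rumorCentrality (recursiveTree a n) p * (n + 1 - size a c n) := by
  have hcp : c ≠ p := by
    rintro rfl
    have := (a k).isLt
    omega
  have h1 : rumorCentrality (recursiveTree a n) c = (n + 1 - size a c n) *
      ∏ u ∈ (Finset.univ.erase c).erase p, (subtree (recursiveTree a n) c u).ncard := by
    rw [rumorCentrality, ← Finset.mul_prod_erase _ _
      (Finset.mem_erase.2 ⟨hcp.symm, Finset.mem_univ p⟩), subtree_child_parent a hc hp,
      Set.ncard_compl, ncard_descendants, Nat.card_eq_fintype_card, Fintype.card_fin]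
  have h2 : rumorCentrality (recursiveTree a n) p = size a c n *
      ∏ u ∈ (Finset.univ.erase c).erase p, (subtree (recursiveTree a n) c u).ncard := by
    rw [rumorCentrality, ← Finset.mul_prod_erase _ _
      (Finset.mem_erase.2 ⟨hcp, Finset.mem_univ c⟩), subtree_parent_child a hc hp,
      ncard_descendants, Finset.erase_right_comm]
    congr 1
    refine Finset.prod_congr rfl fun u hu => ?_
    rw [Finset.mem_erase, Finset.mem_erase] at hu
    rw [subtree_child_eq_subtree_parent a hc hp hu.2.1 hu.1]
  rw [h1, h2]
  ring

lemma rootPath_zero : rootPath a 0 = ∅ := by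
  simp [rootPath, ancestors_zero]

lemma rootPath_succ (k : ℕ) : rootPath a (k + 1) = insert (k + 1) (rootPath a (a k)) := by
  rw [rootPath, ancestors_succ, Finset.erase_insert_of_ne (Nat.succ_ne_zero k), rootPath]

lemma succ_notMem_rootPath (k : ℕ) : k + 1 ∉ rootPath a (a k) := fun h =>
  succ_notMem_ancestors_parent k (Finset.mem_of_mem_erase h)

/-- `rumorCentrality_child` telescoped along the path to the root. -/
lemma rumorCentrality_mul_prod {n : ℕ} (v : Fin (n + 1)) :
    rumorCentrality (recursiveTree a n) v * ∏ c ∈ rootPath a v, size a c n =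
      rumorCentrality (recursiveTree a n) 0 * ∏ c ∈ rootPath a v, (n + 1 - size a c n) := by
  obtain ⟨w, hw⟩ := v
  induction w using parent_induction a with
  | zero => simp [rootPath_zero]
  | succ k ih =>
    have hk := (a k).isLt
    have h1 := rumorCentrality_child a (n := n) (k := k) (c := ⟨k + 1, hw⟩)
      (p := ⟨a k, by omega⟩) rfl rfl
    have h2 := ih (by omega)
    simp only at h1 h2
    simp only [rootPath_succ, Finset.prod_insert (succ_notMem_rootPath a k)]
    rw [← mul_assoc, h1, mul_right_comm, h2]
    ring

lemma size_pos {u n : ℕ} (h : u ≤ n) : 0 < size a u n :=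
  Finset.card_pos.2 ⟨u, Finset.mem_filter.2
    ⟨Finset.mem_range.2 (by omega), self_mem_ancestors u⟩⟩

lemma rumorCentrality_le_root_iff {n : ℕ} (v : Fin (n + 1)) :
    rumorCentrality (recursiveTree a n) v ≤ rumorCentrality (recursiveTree a n) 0 ↔
      ∏ c ∈ rootPath a v, (n + 1 - size a c n) ≤ ∏ c ∈ rootPath a v, size a c n := by
  have hpos : 0 < ∏ c ∈ rootPath a v, size a c n := Finset.prod_pos fun c hc =>
    size_pos a ((le_of_mem_ancestors (Finset.mem_of_mem_erase hc)).trans v.is_le)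
  rw [← Nat.mul_le_mul_right_iff hpos, rumorCentrality_mul_prod,
    Nat.mul_le_mul_left_iff (rumorCentrality_pos a n 0)]

/-- The rank of the root in terms of the numbers of descendants. -/
lemma rank_root_eq (n : ℕ) :
    rank (rumorCentrality (recursiveTree a n)) 0 =
      1 + ((Finset.Ico 1 (n + 1)).filter fun v =>
        ∏ c ∈ rootPath a v, (n + 1 - size a c n) ≤ ∏ c ∈ rootPath a v, size a c n).card := by
  classical
  rw [rank, Set.ncard_eq_toFinset_card']
  congr 1
  refine Finset.card_bij (fun w _ => w.val) ?_ ?_ ?_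
  · intro w hw
    simp only [Set.mem_toFinset, Set.mem_ofPred_eq] at hw
    rw [Finset.mem_filter, Finset.mem_Ico, ← rumorCentrality_le_root_iff]
    rcases hw with h | h
    · refine ⟨⟨Nat.one_le_iff_ne_zero.2 fun h0 => ?_, w.isLt⟩, h.le⟩
      rw [(Fin.ext h0 : w = 0)] at h
      exact lt_irrefl _ h
    · exact ⟨⟨h.2, w.isLt⟩, h.1.le⟩
  · intro w _ w' _ h
    exact Fin.ext h
  · intro w hw
    rw [Finset.mem_filter, Finset.mem_Ico] at hw
    refine ⟨⟨w, hw.1.2⟩, ?_, rfl⟩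
    simp only [Set.mem_toFinset, Set.mem_ofPred_eq]
    have := (rumorCentrality_le_root_iff a ⟨w, hw.1.2⟩).2 hw.2
    rcases this.lt_or_eq with h | h
    · exact Or.inl h
    · exact Or.inr ⟨h, hw.1.1⟩

end Graph

lemma recursiveTree_congr {a b : Attachment} {n : ℕ} (h : ∀ k < n, a k = b k) :
    recursiveTree a n = recursiveTree b n := by
  induction n with
  | zero => rfl
  | succ n ih =>
    rw [recursiveTree, recursiveTree, ih fun k hk => h k (by omega), h n (by omega)]

/-! ### Deterministic criterion for the rank to stabilise -/

open Filter Topology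

/-- The proportion of descendants of `u` among the vertices `0, …, n`. -/
noncomputable def frac (a : Attachment) (u n : ℕ) : ℝ := size a u n / (n + 1)

/-- The vertex `v` is at least as central as the root exactly when this difference is not
positive. -/
noncomputable def pathGap (a : Attachment) (v n : ℕ) : ℝ :=
  ∏ c ∈ rootPath a v, (1 - frac a c n) - ∏ c ∈ rootPath a v, frac a c n

/-- The proportions of descendants of the vertices other than the root converge to limits
different from `0` and `1`. -/
def HasProperLimits (a : Attachment) : Prop :=
  ∀ u, 1 ≤ u → ∃ x : ℝ, 0 < x ∧ x < 1 ∧ Tendsto (frac a u) atTop (𝓝 x)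

section Deterministic

variable (a : Attachment)

lemma frac_nonneg (u n : ℕ) : 0 ≤ frac a u n := by unfold frac; positivity

lemma frac_le_one (u n : ℕ) : frac a u n ≤ 1 := by
  unfold frac
  rw [div_le_one (by positivity)]
  exact_mod_cast size_le a u n

lemma frac_pos {u n : ℕ} (h : u ≤ n) : 0 < frac a u n := by
  have : (0 : ℝ) < size a u n := by exact_mod_cast size_pos a h
  unfold frac
  positivity

lemma one_sub_frac (u n : ℕ) : 1 - frac a u n = ((n + 1 - size a u n : ℕ) : ℝ) / (n + 1) := by
  have : ((n : ℝ) + 1) ≠ 0 := by positivity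
  rw [Nat.cast_sub (size_le a u n), frac]
  push_cast
  field_simp

lemma pathGap_nonpos_iff (v n : ℕ) :
    pathGap a v n ≤ 0 ↔
      ∏ c ∈ rootPath a v, (n + 1 - size a c n) ≤ ∏ c ∈ rootPath a v, size a c n := by
  simp only [pathGap, one_sub_frac, sub_nonpos]
  simp only [frac, Finset.prod_div_distrib]
  rw [div_le_div_iff_of_pos_right (Finset.prod_pos fun _ _ => by positivity)]
  exact_mod_cast Iff.rfl

lemma one_le_of_mem_rootPath {c v : ℕ} (h : c ∈ rootPath a v) : 1 ≤ c :=
  Nat.one_le_iff_ne_zero.2 (Finset.ne_of_mem_erase h)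

lemma le_of_mem_rootPath {c v : ℕ} (h : c ∈ rootPath a v) : c ≤ v :=
  le_of_mem_ancestors (Finset.mem_of_mem_erase h)

lemma self_mem_rootPath {v : ℕ} (h : 1 ≤ v) : v ∈ rootPath a v :=
  Finset.mem_erase.2 ⟨by omega, self_mem_ancestors v⟩

variable {a}

/-- Only boundedly many vertices are ever at least as central as the root. -/
lemma HasProperLimits.pathGap_pos (h : HasProperLimits a)
    (hsmall : ∀ δ : ℝ, 0 < δ → ∃ V, ∀ v ≥ V, ∀ n ≥ v, frac a v n < δ) :
    ∃ V, ∀ᶠ n in atTop, ∀ v, V ≤ v → v ≤ n → 0 < pathGap a v n := by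
  choose! x hx0 hx1 hx using h
  obtain ⟨V₁, hV₁⟩ := hsmall (1 / 2) (by norm_num)
  -- Beyond `V₁` every proportion is below `1 / 2`, so a factor `1 - frac` dominates `frac`. Only
  -- the finitely many labels below `V₁` can lose, and `κ` bounds their total loss independently of
  -- the path.
  set κ : ℝ := ∏ c ∈ Finset.Ico 1 V₁, ((1 - x c) / 2) with hκ
  have hκ0 : 0 < κ := Finset.prod_pos fun c hc => by
    have := hx1 c (Finset.mem_Ico.1 hc).1
    linarith
  obtain ⟨V₂, hV₂⟩ := hsmall (κ / 2) (by positivity)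
  have hev : ∀ᶠ n in atTop, ∀ c ∈ Finset.Ico 1 V₁, frac a c n < (1 + x c) / 2 := by
    rw [eventually_all_finset]
    intro c hc
    have hc1 := (Finset.mem_Ico.1 hc).1
    exact (hx c hc1).eventually_lt_const (by have := hx1 c hc1; linarith)
  refine ⟨max 1 (max V₁ V₂), hev.mono fun n hn v hv hvn => ?_⟩
  simp only [max_le_iff] at hv
  obtain ⟨hv1, hvV₁, hvV₂⟩ := hv
  have hmem := self_mem_rootPath a hv1
  set P := (rootPath a v).erase v with hP
  -- The factor-wise loss: `g c * frac a c n ≤ 1 - frac a c n` at every proper ancestor `c` of `v`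
  -- other than the root.
  set g : ℕ → ℝ := fun c => if c < V₁ then (1 - x c) / 2 else 1 with hg
  have hPle : ∀ c ∈ P, 1 ≤ c ∧ c ≤ n := fun c hc =>
    ⟨one_le_of_mem_rootPath a (Finset.mem_of_mem_erase hc),
      (le_of_mem_rootPath a (Finset.mem_of_mem_erase hc)).trans hvn⟩
  have hg0 : ∀ c, 1 ≤ c → 0 ≤ g c ∧ g c ≤ 1 := by
    intro c hc
    have h0 := hx0 c hc
    have h1 := hx1 c hc
    simp only [hg]
    split_ifs
    · constructor <;> linarith
    · norm_num
  have hgκ : κ ≤ ∏ c ∈ P, g c := by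
    have h1 : ∏ c ∈ P, g c = ∏ c ∈ P.filter (· < V₁), ((1 - x c) / 2) := by
      rw [Finset.prod_filter]
    rw [h1, hκ, ← Finset.prod_sdiff (s₁ := P.filter (· < V₁)) (s₂ := Finset.Ico 1 V₁)]
    · refine mul_le_of_le_one_left (Finset.prod_nonneg fun c hc => ?_)
        (Finset.prod_le_one (fun c hc => ?_) fun c hc => ?_)
      · have := hx1 c (hPle c (Finset.mem_of_mem_filter c hc)).1
        linarith
      · have := hx1 c (Finset.mem_Ico.1 (Finset.mem_sdiff.1 hc).1).1
        linarith
      · have := hx0 c (Finset.mem_Ico.1 (Finset.mem_sdiff.1 hc).1).1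
        linarith
    · intro c hc
      rw [Finset.mem_filter] at hc
      exact Finset.mem_Ico.2 ⟨(hPle c hc.1).1, hc.2⟩
  have hlow : (∏ c ∈ P, g c) * ∏ c ∈ P, frac a c n ≤ ∏ c ∈ P, (1 - frac a c n) := by
    rw [← Finset.prod_mul_distrib]
    refine Finset.prod_le_prod (fun c hc => mul_nonneg (hg0 c (hPle c hc).1).1
      (frac_nonneg a c n)) fun c hc => ?_
    obtain ⟨hc1, hcn⟩ := hPle c hc
    have hf1 := frac_le_one a c n
    have hf0 := frac_nonneg a c n
    simp only [hg]
    split_ifs with hcV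
    · have h1 := hn c (Finset.mem_Ico.2 ⟨hc1, hcV⟩)
      have h2 := hx1 c hc1
      nlinarith
    · have := hV₁ c (not_lt.1 hcV) n hcn
      linarith
  have hv2 := hV₂ v hvV₂ n hvn
  have hv3 := hV₁ v hvV₁ n hvn
  have hprod : 0 < ∏ c ∈ P, frac a c n :=
    Finset.prod_pos fun c hc => frac_pos a (hPle c hc).2
  rw [pathGap, ← Finset.mul_prod_erase _ _ hmem, ← Finset.mul_prod_erase _ _ hmem, sub_pos]
  calc frac a v n * ∏ c ∈ P, frac a c n
      < (κ / 2) * ∏ c ∈ P, frac a c n := by gcongr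
    _ = (1 / 2) * (κ * ∏ c ∈ P, frac a c n) := by ring
    _ ≤ (1 / 2) * ∏ c ∈ P, (1 - frac a c n) := by
        gcongr
        exact le_trans (by gcongr) hlow
    _ ≤ (1 - frac a v n) * ∏ c ∈ P, (1 - frac a c n) := by
        gcongr
        · exact Finset.prod_nonneg fun c _ => by linarith [frac_le_one a c n]
        · linarith

lemma HasProperLimits.exists_tendsto_pathGap (h : HasProperLimits a) (v : ℕ) :
    ∃ y, Tendsto (pathGap a v) atTop (𝓝 y) := by
  choose! x hx0 hx1 hx using h
  exact ⟨_, (tendsto_finsetProd _ fun c hc =>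
    (hx c (one_le_of_mem_rootPath a hc)).const_sub 1).sub
      (tendsto_finsetProd _ fun c hc => hx c (one_le_of_mem_rootPath a hc))⟩

/-- The rank of the root is eventually constant along every well-behaved attachment sequence. -/
lemma HasProperLimits.eventually_rank_eq (h : HasProperLimits a)
    (hsmall : ∀ δ : ℝ, 0 < δ → ∃ V, ∀ v ≥ V, ∀ n ≥ v, frac a v n < δ)
    (hgap : ∀ v, 1 ≤ v → ¬ Tendsto (pathGap a v) atTop (𝓝 0)) :
    ∃ K, ∀ᶠ n in atTop, rank (rumorCentrality (recursiveTree a n)) 0 = K := by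
  classical
  obtain ⟨V, hV⟩ := h.pathGap_pos hsmall
  choose y hy using h.exists_tendsto_pathGap
  have hsign : ∀ᶠ n in atTop, ∀ v ∈ Finset.Ico 1 V, (pathGap a v n ≤ 0 ↔ y v ≤ 0) := by
    rw [eventually_all_finset]
    intro v hv
    have hne : y v ≠ 0 := fun h0 => hgap v (Finset.mem_Ico.1 hv).1 (h0 ▸ hy v)
    rcases hne.lt_or_gt with h0 | h0
    · filter_upwards [(hy v).eventually_lt_const h0] with n hn
      exact iff_of_true hn.le h0.le
    · filter_upwards [(hy v).eventually_const_lt h0] with n hn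
      exact iff_of_false hn.not_ge h0.not_ge
  refine ⟨1 + ((Finset.Ico 1 V).filter fun v => y v ≤ 0).card, ?_⟩
  filter_upwards [hV, hsign, eventually_ge_atTop V] with n h1 h2 h3
  rw [rank_root_eq]
  simp only [← pathGap_nonpos_iff]
  congr 2
  ext v
  simp only [Finset.mem_filter, Finset.mem_Ico]
  constructor
  · rintro ⟨⟨hv1, hvn⟩, hle⟩
    have hvV : v < V := by
      by_contra hvV
      exact absurd (h1 v (not_lt.1 hvV) (by omega)) hle.not_gt
    exact ⟨⟨hv1, hvV⟩, (h2 v (Finset.mem_Ico.2 ⟨hv1, hvV⟩)).1 hle⟩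
  · rintro ⟨⟨hv1, hvV⟩, hle⟩
    exact ⟨⟨hv1, by omega⟩, (h2 v (Finset.mem_Ico.2 ⟨hv1, hvV⟩)).2 hle⟩

end Deterministic

/-! ### The filtration of attachments -/

section Past

/-- The first `n` attachments. -/
def firstAttachments (n : ℕ) (a : Attachment) : ∀ k : Fin n, Fin (k.val + 1) := fun k => a k

lemma measurable_firstAttachments (n : ℕ) : Measurable (firstAttachments n) :=
  measurable_pi_lambda _ fun k => measurable_pi_apply k.val

/-- The filtration generated by the attachments. -/
def past : Filtration ℕ (inferInstance : MeasurableSpace Attachment) where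
  seq n := MeasurableSpace.comap (firstAttachments n) inferInstance
  mono' m n h := by
    have hm : Measurable fun (b : ∀ k : Fin n, Fin (k.val + 1)) (k : Fin m) =>
        b ⟨k, k.isLt.trans_le h⟩ :=
      measurable_pi_lambda _ fun k => measurable_pi_apply (⟨k, k.isLt.trans_le h⟩ : Fin n)
    have := MeasurableSpace.comap_mono (g := firstAttachments n) hm.comap_le
    rwa [MeasurableSpace.comap_comp] at this
  le' n := (measurable_firstAttachments n).comap_le

/-- `f` depends only on the first `n` attachments. -/
def DependsOnFirst {β : Type*} (n : ℕ) (f : Attachment → β) : Prop :=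
  ∀ ⦃a b : Attachment⦄, (∀ k < n, a k = b k) → f a = f b

variable {β : Type*} {n : ℕ} {f : Attachment → β}

/-- Such an `f` factors through a finite type, so measurability and boundedness come for free. -/
lemma DependsOnFirst.exists_eq_comp (hf : DependsOnFirst n f) :
    ∃ g : (∀ k : Fin n, Fin (k.val + 1)) → β, f = g ∘ firstAttachments n := by
  refine ⟨fun b => f fun k => if h : k < n then b ⟨k, h⟩ else 0, funext fun a => hf fun k hk => ?_⟩
  simp [hk, firstAttachments]

lemma DependsOnFirst.measurable_past [MeasurableSpace β] (hf : DependsOnFirst n f) :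
    Measurable[past n] f := by
  obtain ⟨g, rfl⟩ := hf.exists_eq_comp
  exact (measurable_of_finite g).comp (comap_measurable _)

lemma DependsOnFirst.measurable [MeasurableSpace β] (hf : DependsOnFirst n f) :
    Measurable f := hf.measurable_past.mono (past.le n) le_rfl

lemma DependsOnFirst.exists_abs_le {f : Attachment → ℝ} (hf : DependsOnFirst n f) :
    ∃ C, ∀ a, |f a| ≤ C := by
  obtain ⟨g, rfl⟩ := hf.exists_eq_comp
  obtain ⟨C, hC⟩ := (Set.finite_range fun b => |g b|).bddAbove
  exact ⟨C, fun a => hC ⟨firstAttachments n a, rfl⟩⟩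

lemma iSup_past : ⨆ n, past n = (inferInstance : MeasurableSpace Attachment) := by
  refine le_antisymm (iSup_le past.le) (iSup_le fun k => ?_)
  have : Measurable[past (k + 1)] fun a : Attachment => a k :=
    DependsOnFirst.measurable_past fun a b h => h k (Nat.lt_succ_self k)
  exact this.comap_le.trans (le_iSup (fun n => (past n : MeasurableSpace Attachment)) (k + 1))

/-- Measurability of `U n` is not required, so the lemma applies to the σ-algebra generated by the
other attachments. -/
lemma measurable_update_of_ne {Ω : Type*} [MeasurableSpace Ω] {U : ∀ n : ℕ, Ω → Fin (n + 1)}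
    {n : ℕ} (h : ∀ k, k ≠ n → Measurable (U k)) (i : Fin (n + 1)) :
    Measurable fun ω => Function.update (fun k => U k ω) n i :=
  measurable_pi_lambda _ fun k => by
    by_cases hk : k = n
    · subst hk
      simp
    · simpa [Function.update_of_ne hk] using h k hk

lemma measurable_update_attachment (n : ℕ) (i : Fin (n + 1)) :
    Measurable fun a : Attachment => Function.update a n i :=
  measurable_update_of_ne (U := fun k (a : Attachment) => a k) (fun k _ => measurable_pi_apply k) i

lemma update_mem_iff {G : Set Attachment} (hG : MeasurableSet[past n] G) (a : Attachment)
    (i : Fin (n + 1)) : Function.update a n i ∈ G ↔ a ∈ G := by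
  obtain ⟨S, -, rfl⟩ := hG
  have : firstAttachments n (Function.update a n i) = firstAttachments n a :=
    funext fun k => Function.update_of_ne k.isLt.ne _ _
  rw [Set.mem_preimage, Set.mem_preimage, this]

end Past

/-! ### Resampling one attachment -/

/-- The law `ν` is invariant under resampling any single attachment uniformly. -/
def ResamplingInvariant (ν : Measure Attachment) : Prop :=
  ∀ (n : ℕ) (S : Set Attachment), MeasurableSet S →
    ν S = ((n + 1 : ℕ) : ℝ≥0∞)⁻¹ * ∑ i, ν ((fun a => Function.update a n i) ⁻¹' S)

/-- Split by the value `i` of `U n`: on that piece, overwriting by `i` changes nothing, and the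
overwritten sequence is independent of `U n`. -/
lemma IsUniformAttachment.resamplingInvariant {Ω : Type*} [MeasurableSpace Ω] {μ : Measure Ω}
    [IsProbabilityMeasure μ] {U : ∀ n : ℕ, Ω → Fin (n + 1)} (hU : IsUniformAttachment μ U) :
    ResamplingInvariant (μ.map fun ω n => U n ω) := by
  have hm : Measurable fun ω n => U n ω := measurable_pi_lambda _ hU.measurable
  intro n S hS
  rw [Measure.map_apply hm hS, Finset.mul_sum]
  have hind := indep_iSup_of_disjoint (fun k => (hU.measurable k).comap_le) hU.indep
    (S := {n}) (T := {n}ᶜ) disjoint_compl_right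
  have hpart : (fun ω n => U n ω) ⁻¹' S =
      ⋃ i, {ω | U n ω = i} ∩ {ω | Function.update (fun k => U k ω) n i ∈ S} := by
    ext ω
    simp only [Set.mem_preimage, Set.mem_iUnion, Set.mem_inter_iff, Set.mem_ofPred_eq]
    constructor
    · intro h
      exact ⟨U n ω, rfl, by rwa [Function.update_eq_self n fun k => U k ω]⟩
    · rintro ⟨i, rfl, h⟩
      rwa [Function.update_eq_self n fun k => U k ω] at h
  have hms : ∀ i, MeasurableSet {ω | U n ω = i} := fun i =>
    hU.measurable n (measurableSet_singleton i)
  have hupd : ∀ i : Fin (n + 1), Measurable[⨆ k ∈ ({n}ᶜ : Set ℕ), MeasurableSpace.comap (U k)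
      inferInstance] fun ω => Function.update (fun k => U k ω) n i := by
    intro i
    refine @measurable_update_of_ne Ω (⨆ k ∈ ({n}ᶜ : Set ℕ), MeasurableSpace.comap (U k)
      inferInstance) U n (fun k h => ?_) i
    exact (comap_measurable (U k)).mono
      (le_iSup₂_of_le (f := fun k (_ : k ∈ ({n}ᶜ : Set ℕ)) => MeasurableSpace.comap (U k) _)
        k h le_rfl) le_rfl
  have hmu : ∀ i, MeasurableSet {ω | Function.update (fun k => U k ω) n i ∈ S} := fun i =>
    hm ((measurable_update_attachment n i) hS)
  rw [hpart, measure_iUnion _ fun i => (hms i).inter (hmu i), tsum_fintype]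
  · refine Finset.sum_congr rfl fun i _ => ?_
    rw [Measure.map_apply hm ((measurable_update_attachment n i) hS), ← hU.uniform n i]
    refine (Indep_iff _ _ _).1 hind _ _ ?_ (hupd i hS)
    exact (le_iSup₂_of_le (f := fun k (_ : k ∈ ({n} : Set ℕ)) => MeasurableSpace.comap (U k) _)
      n rfl le_rfl) _ ⟨{i}, measurableSet_singleton i, rfl⟩
  · intro i j hij
    refine Set.disjoint_left.2 ?_
    rintro ω ⟨rfl, -⟩ ⟨h, -⟩
    exact hij h

/-- The average of `f` over the possible values of the `n`-th attachment. -/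
noncomputable def average (n : ℕ) (f : Attachment → ℝ) (a : Attachment) : ℝ :=
  (n + 1 : ℝ)⁻¹ * ∑ i, f (Function.update a n i)

lemma measurable_average {f : Attachment → ℝ} (hf : Measurable f) (n : ℕ) :
    Measurable (average n f) :=
  (Finset.measurable_sum _ fun i _ =>
    hf.comp (measurable_update_attachment n i)).const_mul _

lemma abs_average_le {f : Attachment → ℝ} {C : ℝ} (hf : ∀ a, |f a| ≤ C) (n : ℕ)
    (a : Attachment) : |average n f a| ≤ C := by
  rw [average, abs_mul, abs_of_nonneg (by positivity), inv_mul_le_iff₀ (by positivity)]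
  refine (Finset.abs_sum_le_sum_abs _ _).trans ((Finset.sum_le_card_nsmul _ _ C
    fun i _ => hf _).trans ?_)
  simp

lemma integrable_of_abs_le {ν : Measure Attachment} [IsFiniteMeasure ν] {f : Attachment → ℝ}
    {C : ℝ} (hm : Measurable f) (hf : ∀ a, |f a| ≤ C) : Integrable f ν :=
  Integrable.of_bound hm.aestronglyMeasurable C (ae_of_all _ hf)

namespace ResamplingInvariant

variable {ν : Measure Attachment} (hν : ResamplingInvariant ν)
include hν

lemma eq_smul_sum (n : ℕ) : ν = ((n + 1 : ℕ) : ℝ≥0∞)⁻¹ •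
    ∑ i : Fin (n + 1), ν.map fun a => Function.update a n i := by
  ext S hS
  rw [hν n S hS, Measure.smul_apply, Measure.finsetSum_apply, smul_eq_mul]
  congr 1
  exact Finset.sum_congr rfl fun i _ =>
    (Measure.map_apply (measurable_update_attachment n i) hS).symm

variable [IsProbabilityMeasure ν]

lemma integral_average {f : Attachment → ℝ} {C : ℝ} (hm : Measurable f) (hf : ∀ a, |f a| ≤ C)
    (n : ℕ) : ∫ a, average n f a ∂ν = ∫ a, f a ∂ν := by
  have hu := measurable_update_attachment n
  have hint : ∀ i, Integrable (fun a => f (Function.update a n i)) ν := fun i =>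
    integrable_of_abs_le (hm.comp (hu i)) fun a => hf _
  conv_rhs => rw [hν.eq_smul_sum n]
  rw [integral_smul_measure, integral_finsetSum_measure fun i _ =>
    (integrable_map_measure hm.aestronglyMeasurable (hu i).aemeasurable).2 (hint i)]
  simp only [average]
  rw [integral_const_mul, integral_finsetSum _ fun i _ => hint i]
  simp only [integral_map (hu _).aemeasurable hm.aestronglyMeasurable]
  rw [ENNReal.toReal_inv, ENNReal.toReal_natCast, Nat.cast_succ, smul_eq_mul]

lemma setIntegral_average {f : Attachment → ℝ} {C : ℝ} (hm : Measurable f)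
    (hf : ∀ a, |f a| ≤ C) (n : ℕ) {G : Set Attachment} (hG : MeasurableSet[past n] G) :
    ∫ a in G, average n f a ∂ν = ∫ a in G, f a ∂ν := by
  have hG' := past.le n _ hG
  rw [← integral_indicator hG', ← integral_indicator hG',
    ← hν.integral_average (f := G.indicator f) (C := C) (hm.indicator hG') _ n]
  · congr 1
    ext a
    by_cases h : a ∈ G <;> simp [average, update_mem_iff hG, h]
  · intro a
    by_cases h : a ∈ G
    · simpa [h] using hf a
    · simpa [h] using (abs_nonneg _).trans (hf a)

/-- Events of `past n` do not involve the `n`-th attachment, so averaging over it preserves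
integrals over them. -/
lemma condExp_average {f : Attachment → ℝ} {C : ℝ} (hm : Measurable f) (hf : ∀ a, |f a| ≤ C)
    (n : ℕ) : ν[average n f | past n] =ᵐ[ν] ν[f | past n] := by
  refine ae_eq_condExp_of_forall_setIntegral_eq (past.le n) (integrable_of_abs_le hm hf)
    (fun s _ _ => integrable_condExp.integrableOn) (fun s hs _ => ?_)
    stronglyMeasurable_condExp.aestronglyMeasurable
  rw [setIntegral_condExp (past.le n) (integrable_of_abs_le (measurable_average hm n)
    (abs_average_le hf n)) hs, hν.setIntegral_average hm hf n hs]

lemma martingale {f : ℕ → Attachment → ℝ} (hf : ∀ n, DependsOnFirst n (f n))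
    (havg : ∀ n a, average n (f (n + 1)) a = f n a) : Martingale f past ν := by
  refine martingale_nat (fun n => (hf n).measurable_past.stronglyMeasurable) (fun n => ?_)
    fun n => ?_
  · obtain ⟨C, hC⟩ := (hf n).exists_abs_le
    exact integrable_of_abs_le (hf n).measurable hC
  · obtain ⟨C, hC⟩ := (hf (n + 1)).exists_abs_le
    have h1 := hν.condExp_average (hf (n + 1)).measurable hC n
    rw [funext (havg n), condExp_of_stronglyMeasurable (past.le n)
      (hf n).measurable_past.stronglyMeasurable] at h1
    · exact h1
    · obtain ⟨C, hC⟩ := (hf n).exists_abs_le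
      exact integrable_of_abs_le (hf n).measurable hC

end ResamplingInvariant

/-! ### The urn of descendants and its martingales -/

section Size

variable {a b : Attachment} {u n : ℕ}

lemma size_congr (h : ∀ k < n, a k = b k) : size a u n = size b u n := by
  unfold size
  congr 1
  refine Finset.filter_congr fun w hw => ?_
  rw [ancestors_congr h (Nat.lt_succ_iff.1 (Finset.mem_range.1 hw))]

lemma ancestors_update (i : Fin (n + 1)) {w : ℕ} (hw : w ≤ n) :
    ancestors (Function.update a n i) w = ancestors a w :=
  ancestors_congr (fun _ hk => Function.update_of_ne hk.ne _ _) hw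

lemma size_update_succ (i : Fin (n + 1)) (hu : u ≤ n) :
    size (Function.update a n i) u (n + 1) =
      size a u n + if u ∈ ancestors a i then 1 else 0 := by
  have h1 : size (Function.update a n i) u n = size a u n :=
    size_congr fun k hk => Function.update_of_ne hk.ne _ _
  have h2 : u ∈ ancestors (Function.update a n i) (n + 1) ↔ u ∈ ancestors a i := by
    rw [mem_ancestors_succ_iff (by omega), Function.update_self, ancestors_update i i.is_le]
  rw [← h1, size, Finset.range_add_one, Finset.filter_insert, size]
  simp only [h2]
  split_ifs
  · rw [Finset.card_insert_of_notMem (by simp)]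
  · rfl

lemma size_self (a : Attachment) (u : ℕ) : size a u u = 1 := by
  rw [size, Finset.card_eq_one]
  refine ⟨u, ?_⟩
  ext w
  rw [Finset.mem_filter, Finset.mem_range, Finset.mem_singleton]
  constructor
  · rintro ⟨h1, h2⟩
    have := le_of_mem_ancestors h2
    omega
  · rintro rfl
    exact ⟨by omega, self_mem_ancestors w⟩

lemma size_lt (hu : 1 ≤ u) (a : Attachment) (n : ℕ) : size a u n < n + 1 := by
  rw [size]
  conv_rhs => rw [← Finset.card_range (n + 1)]
  refine Finset.card_lt_card (Finset.filter_ssubset.2 ⟨0, by simp, ?_⟩)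
  rw [ancestors_zero, Finset.mem_singleton]
  omega

lemma card_descendants (a : Attachment) (u n : ℕ) :
    (Finset.univ.filter fun i : Fin (n + 1) => u ∈ ancestors a i).card = size a u n := by
  rw [size, Finset.card_filter, Finset.card_filter,
    Finset.sum_range fun w => if u ∈ ancestors a w then 1 else 0]

/-- The urn step: exactly `size a u n` of the `n + 1` choices add a descendant of `u`. -/
lemma average_size (F : ℕ → ℝ) (hu : u ≤ n) (a : Attachment) :
    average n (fun a => F (size a u (n + 1))) a = (n + 1 : ℝ)⁻¹ *
      (size a u n * F (size a u n + 1) + (n + 1 - size a u n) * F (size a u n)) := by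
  have h1 : ∀ i : Fin (n + 1), F (size (Function.update a n i) u (n + 1)) =
      F (size a u n) + if u ∈ ancestors a i then F (size a u n + 1) - F (size a u n) else 0 := by
    intro i
    rw [size_update_succ i hu]
    split_ifs <;> simp
  simp only [average, h1]
  rw [Finset.sum_add_distrib, ← Finset.sum_filter, Finset.sum_const, Finset.sum_const,
    card_descendants, Finset.card_univ, Fintype.card_fin, nsmul_eq_mul, nsmul_eq_mul]
  push_cast
  ring

end Size

/-- Time is frozen at `u` until vertex `u` is born; there its size is `1`, whatever the attachments.
-/
lemma dependsOnFirst_size {β : Type*} (F : ℕ → β) (u n : ℕ) :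
    DependsOnFirst n fun a => F (size a u (max n u)) := by
  intro a b h
  rcases le_total n u with hn | hn
  · simp only [max_eq_right hn, size_self]
  · simp only [max_eq_left hn, size_congr h]

namespace ResamplingInvariant

variable {ν : Measure Attachment} (hν : ResamplingInvariant ν) [IsProbabilityMeasure ν]
include hν

/-- `hF` is the harmonicity condition for an urn with `s` of `N` balls marked; `s < N` because the
root is never a descendant of `u ≥ 1`. -/
lemma martingale_size {F : ℕ → ℕ → ℝ} (hF : ∀ s N : ℕ, 1 ≤ s → s < N →
      s * F (s + 1) (N + 1) + (N - s) * F s (N + 1) = N * F s N) {u : ℕ} (hu : 1 ≤ u) :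
    Martingale (fun n a => F (size a u (max n u)) (max n u + 1)) past ν := by
  refine hν.martingale (fun n => dependsOnFirst_size (fun s => F s (max n u + 1)) u n)
    fun n a => ?_
  rcases lt_or_ge n u with hn | hn
  · simp only [max_eq_right hn.le, max_eq_right (Nat.succ_le_of_lt hn), size_self, average]
    simp only [Finset.sum_const, Finset.card_univ, Fintype.card_fin, nsmul_eq_mul]
    push_cast
    field_simp
  · simp only [max_eq_left hn, max_eq_left (hn.trans (Nat.le_succ n))]
    rw [average_size (fun s => F s (n + 1 + 1)) hn,
      inv_mul_eq_iff_eq_mul₀ (by positivity)]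
    have := hF (size a u n) (n + 1) (size_pos a hn) (size_lt hu a n)
    push_cast at this
    exact this

end ResamplingInvariant

/-- Nonnegativity makes the `L¹` norm equal to the constant expectation, so the martingale is
bounded in `L¹`. -/
lemma ae_tendsto_of_martingale_of_nonneg {ν : Measure Attachment}
    [IsProbabilityMeasure ν] {f : ℕ → Attachment → ℝ} (hf : Martingale f past ν) (h0 : ∀ n a, 0 ≤ f n a) :
    ∀ᵐ a ∂ν, ∃ c, Tendsto (fun n => f n a) atTop (𝓝 c) := by
  refine hf.submartingale.exists_ae_tendsto_of_bdd (R := (∫ a, f 0 a ∂ν).toNNReal) fun n => ?_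
  have h1 : ∫ a, f n a ∂ν = ∫ a, f 0 a ∂ν := by
    have := hf.setIntegral_eq (Nat.zero_le n) (s := Set.univ) MeasurableSet.univ
    simpa using this.symm
  rw [eLpNorm_one_eq_lintegral_enorm, ← ofReal_integral_norm_eq_lintegral_enorm (hf.integrable n)]
  simp only [Real.norm_of_nonneg (h0 n _), h1]
  exact le_rfl

/-- The ratio of `Γ (s - 1 / 2)` and `Γ s`, up to a constant factor. -/
noncomputable def halfRatio (s : ℕ) : ℝ := ∏ j ∈ Finset.Ico 1 s, (1 - 1 / (2 * (j : ℝ)))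

lemma halfRatio_succ {s : ℕ} (hs : 1 ≤ s) :
    halfRatio (s + 1) = halfRatio s * (1 - 1 / (2 * (s : ℝ))) := by
  rw [halfRatio, Finset.prod_Ico_succ_top hs, halfRatio]

lemma halfRatio_pos (s : ℕ) : 0 < halfRatio s := by
  refine Finset.prod_pos fun j hj => ?_
  have h : (1 : ℝ) ≤ j := by exact_mod_cast (Finset.mem_Ico.1 hj).1
  have : 1 / (2 * (j : ℝ)) ≤ 1 / 2 := by
    apply one_div_le_one_div_of_le <;> linarith
  linarith

/-- One step amounts to `(2 * N - 1) ^ 2 * (N + 1) ≤ 4 * N ^ 3`. -/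
lemma halfRatio_sq_mul_antitone {s N : ℕ} (hs : 1 ≤ s) (h : s ≤ N) :
    halfRatio N ^ 2 * N ≤ halfRatio s ^ 2 * s := by
  induction N, h using Nat.le_induction with
  | base => exact le_rfl
  | succ N h ih =>
    refine le_trans ?_ ih
    have hN : (1 : ℝ) ≤ N := by exact_mod_cast hs.trans h
    rw [halfRatio_succ (hs.trans h), mul_pow, mul_assoc]
    refine mul_le_mul_of_nonneg_left ?_ (sq_nonneg _)
    have hpos : (0 : ℝ) < N := by linarith
    rw [show (1 : ℝ) - 1 / (2 * N) = (2 * N - 1) / (2 * N) by field_simp, div_pow,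
      div_mul_eq_mul_div, div_le_iff₀ (by positivity)]
    push_cast
    nlinarith

/-- By `halfRatio_succ`, the numerators on the left sum to `(N - 1 / 2) * halfRatio s`, and
`halfRatio (N + 1)` carries the same factor `N - 1 / 2`. -/
lemma halfRatio_recurrence {s N : ℕ} (hs : 1 ≤ s) (h : s < N) :
    (s : ℝ) * (halfRatio (s + 1) / halfRatio (N + 1)) +
      (N - s) * (halfRatio s / halfRatio (N + 1)) = N * (halfRatio s / halfRatio N) := by
  have h1 := halfRatio_pos N
  have h2 := halfRatio_pos (N + 1)
  have hs' : (1 : ℝ) ≤ s := by exact_mod_cast hs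
  have hN : (1 : ℝ) ≤ N := by exact_mod_cast hs.trans h.le
  have h3 : halfRatio (N + 1) = halfRatio N * (1 - 1 / (2 * (N : ℝ))) := halfRatio_succ (by omega)
  rw [← mul_div_assoc, ← mul_div_assoc, ← add_div, ← mul_div_assoc,
    div_eq_div_iff h2.ne' h1.ne', h3, halfRatio_succ hs]
  field_simp
  ring

/-- If the ratio of the values of `halfRatio` stays bounded, then `s` is of order `N`. -/
lemma inv_sq_le_div_of_halfRatio_le {s N : ℕ} {B : ℝ} (hs : 1 ≤ s) (h : s ≤ N)
    (hB : halfRatio s / halfRatio N ≤ B) : (B ^ 2)⁻¹ ≤ (s : ℝ) / N := by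
  have h1 := halfRatio_pos N
  have h2 := halfRatio_pos s
  have hB0 : 0 < B := lt_of_lt_of_le (div_pos h2 h1) hB
  have hN : (0 : ℝ) < N := by exact_mod_cast hs.trans h
  have hs' : (0 : ℝ) < s := by exact_mod_cast hs
  have h3 := halfRatio_sq_mul_antitone hs h
  rw [div_le_iff₀ h1] at hB
  rw [inv_le_iff_one_le_mul₀ (by positivity), div_mul_eq_mul_div, one_le_div hN]
  have h4 : halfRatio s ^ 2 ≤ (B * halfRatio N) ^ 2 := pow_le_pow_left₀ h2.le hB 2
  have h5 : halfRatio N ^ 2 * N ≤ halfRatio N ^ 2 * (s * B ^ 2) := by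
    calc _ ≤ _ := h3
      _ ≤ (B * halfRatio N) ^ 2 * s := by gcongr
      _ = _ := by ring
  exact le_of_mul_le_mul_left h5 (by positivity)

/-! ### Limits and uniform smallness of the proportions -/

namespace ResamplingInvariant

variable {ν : Measure Attachment} (hν : ResamplingInvariant ν) [IsProbabilityMeasure ν]
include hν

lemma ae_exists_tendsto_frac {u : ℕ} (hu : 1 ≤ u) :
    ∀ᵐ a ∂ν, ∃ x, Tendsto (frac a u) atTop (𝓝 x) := by
  have hM := hν.martingale_size (F := fun s N => (s : ℝ) / N) (fun s N hs h => by
    have : (0 : ℝ) < N := by exact_mod_cast hs.trans h.le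
    push_cast
    field_simp
    ring) hu
  filter_upwards [ae_tendsto_of_martingale_of_nonneg hM fun n a => by positivity] with a ⟨x, hx⟩
  refine ⟨x, hx.congr' ?_⟩
  filter_upwards [eventually_ge_atTop u] with n hn
  rw [max_eq_left hn, frac]
  push_cast
  rfl

/-- The martingale behaves like the proportion to the power `-1 / 2`; as it converges it is bounded,
which keeps the proportion away from `0`. -/
lemma ae_eventually_le_frac {u : ℕ} (hu : 1 ≤ u) :
    ∀ᵐ a ∂ν, ∃ ε : ℝ, 0 < ε ∧ ∀ᶠ n in atTop, ε ≤ frac a u n := by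
  have hM := hν.martingale_size (F := fun s N => halfRatio s / halfRatio N)
    (fun s N hs h => halfRatio_recurrence hs h) hu
  filter_upwards [ae_tendsto_of_martingale_of_nonneg hM fun n a =>
    (div_pos (halfRatio_pos _) (halfRatio_pos _)).le] with a ⟨x, hx⟩
  obtain ⟨B, hB⟩ := hx.bddAbove_range
  have hB' : ∀ n, u ≤ n → halfRatio (size a u n) / halfRatio (n + 1) ≤ B := fun n hn => by
    have := hB ⟨n, rfl⟩
    simpa only [max_eq_left hn] using this
  have hB0 : 0 < B := (div_pos (halfRatio_pos _) (halfRatio_pos _)).trans_le (hB' u le_rfl)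
  refine ⟨(B ^ 2)⁻¹, by positivity, ?_⟩
  filter_upwards [eventually_ge_atTop u] with n hn
  have := inv_sq_le_div_of_halfRatio_le (size_pos a hn) (size_le a u n) (hB' n hn)
  simpa [frac] using this

/-- The same martingale for the complementary urn of non-descendants. -/
lemma ae_eventually_le_one_sub_frac {u : ℕ} (hu : 1 ≤ u) :
    ∀ᵐ a ∂ν, ∃ ε : ℝ, 0 < ε ∧ ∀ᶠ n in atTop, ε ≤ 1 - frac a u n := by
  have hM := hν.martingale_size (F := fun s N => halfRatio (N - s) / halfRatio N)
    (fun s N hs h => by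
      have := halfRatio_recurrence (s := N - s) (N := N) (by omega) (by omega)
      rw [Nat.cast_sub h.le] at this
      rw [← this, show N + 1 - (s + 1) = N - s by omega, show N + 1 - s = N - s + 1 by omega]
      ring) hu
  filter_upwards [ae_tendsto_of_martingale_of_nonneg hM fun n a =>
    (div_pos (halfRatio_pos _) (halfRatio_pos _)).le] with a ⟨x, hx⟩
  obtain ⟨B, hB⟩ := hx.bddAbove_range
  have hB' : ∀ n, u ≤ n → halfRatio (n + 1 - size a u n) / halfRatio (n + 1) ≤ B :=
    fun n hn => by
      have := hB ⟨n, rfl⟩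
      simpa only [max_eq_left hn] using this
  have hB0 : 0 < B := (div_pos (halfRatio_pos _) (halfRatio_pos _)).trans_le (hB' u le_rfl)
  refine ⟨(B ^ 2)⁻¹, by positivity, ?_⟩
  filter_upwards [eventually_ge_atTop u] with n hn
  have hlt := size_lt hu a n
  have := inv_sq_le_div_of_halfRatio_le (by omega) (Nat.sub_le _ _) (hB' n hn)
  rw [one_sub_frac]
  simpa using this

lemma ae_hasProperLimits : ∀ᵐ a ∂ν, HasProperLimits a := by
  refine ae_all_iff.2 fun u => ?_
  by_cases hu : 1 ≤ u
  · filter_upwards [hν.ae_exists_tendsto_frac hu, hν.ae_eventually_le_frac hu,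
      hν.ae_eventually_le_one_sub_frac hu] with a ⟨x, hx⟩ ⟨ε, hε, h1⟩ ⟨δ, hδ, h2⟩ _
    refine ⟨x, hε.trans_le (ge_of_tendsto hx h1), ?_, hx⟩
    have := ge_of_tendsto (hx.const_sub 1) h2
    linarith
  · exact ae_of_all _ fun a h => absurd h hu

/-- Doob's maximal inequality for the martingale `s (s + 1) / (N (N + 1))`, started at `s = 1`, `N =
u + 1`. A quadratic martingale is used because its bound is summable in `u`. -/
lemma measure_exists_le_frac_le {δ : ℝ} (hδ : 0 < δ) (hδ1 : δ ≤ 1) {u : ℕ} (hu : 1 ≤ u) :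
    ν {a | ∃ n ≥ u, δ ≤ frac a u n} ≤
      ENNReal.ofReal (2 / δ ^ 2 * (1 / ((u + 1) * (u + 2)))) := by
  have hM := hν.martingale_size
    (F := fun s N => ((s : ℝ) * (s + 1)) / (N * (N + 1))) (fun s N hs h => by
      have : (0 : ℝ) < N := by exact_mod_cast hs.trans h.le
      push_cast
      field_simp
      ring) hu
  set f : ℕ → Attachment → ℝ := fun n a => ((size a u (max n u) : ℝ) *
    (size a u (max n u) + 1)) / ((max n u + 1 : ℕ) * ((max n u + 1 : ℕ) + 1)) with hf
  have hf0 : 0 ≤ f := fun n a => by simp only [hf, Pi.zero_apply]; positivity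
  have hE : ∀ n, ∫ a, f n a ∂ν = 2 / ((u + 1) * (u + 2)) := by
    intro n
    have h1 := hM.setIntegral_eq (Nat.zero_le n) (s := Set.univ) MeasurableSet.univ
    simp only [Measure.restrict_univ] at h1
    rw [← h1]
    simp only [hf, Nat.zero_max, size_self]
    simp
    ring
  set ε : NNReal := ⟨δ ^ 2, by positivity⟩ with hε
  set A : ℕ → Set Attachment := fun n => {a | (ε : ℝ) ≤ (Finset.range (n + 1)).sup'
    Finset.nonempty_range_add_one fun k => f k a} with hA
  have hAn : ∀ n, ν (A n) ≤ ENNReal.ofReal (2 / δ ^ 2 * (1 / ((u + 1) * (u + 2)))) := by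
    intro n
    have h1 := maximal_ineq hM.submartingale hf0 (ε := ε) n
    have h2 : ENNReal.ofReal (∫ a in A n, f n a ∂ν) ≤
        ENNReal.ofReal (2 / ((u + 1) * (u + 2))) := by
      rw [← hE n]
      exact ENNReal.ofReal_le_ofReal (setIntegral_le_integral (hM.integrable n)
        (ae_of_all _ (hf0 n)))
    have h3 := h1.trans h2
    rw [show (2 : ℝ) / δ ^ 2 * (1 / ((u + 1) * (u + 2))) = 2 / ((u + 1) * (u + 2)) / δ ^ 2 by ring,
      ENNReal.ofReal_div_of_pos (by positivity), ENNReal.le_div_iff_mul_le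
        (Or.inl (by simpa using hδ.ne')) (Or.inl ENNReal.ofReal_ne_top), mul_comm]
    have h4 : ENNReal.ofReal (δ ^ 2) = ε :=
      ENNReal.ofReal_eq_coe_nnreal (sq_nonneg δ)
    rw [h4]
    exact h3
  have hmono : Monotone A := by
    intro m n hmn a ha
    exact le_trans (show (ε : ℝ) ≤ _ from ha) (Finset.sup'_mono _ (Finset.range_mono (Nat.succ_le_succ hmn)) _)
  have hsub : {a | ∃ n ≥ u, δ ≤ frac a u n} ⊆ ⋃ n, A n := by
    rintro a ⟨n, hn, hδn⟩
    refine Set.mem_iUnion.2 ⟨n, ?_⟩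
    refine le_trans ?_ (Finset.le_sup' (fun k => f k a) (Finset.self_mem_range_succ n))
    simp only [hf, max_eq_left hn]
    rw [frac, le_div_iff₀ (by positivity)] at hδn
    change δ ^ 2 ≤ _
    rw [le_div_iff₀ (by positivity)]
    push_cast
    -- Here `δ ≤ 1` is needed: adding one to both `s` and `N` keeps the ratio at least `δ`.
    have h1 : δ * (n + 1 + 1) ≤ size a u n + 1 := by linarith
    calc δ ^ 2 * ((n + 1) * (n + 1 + 1)) = (δ * (n + 1)) * (δ * (n + 1 + 1)) := by ring
      _ ≤ _ := mul_le_mul hδn h1 (by positivity) (by positivity)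
  refine (measure_mono hsub).trans ?_
  rw [hmono.measure_iUnion]
  exact iSup_le hAn

/-- Borel–Cantelli over the vertices, for the countably many thresholds `1 / (j + 1)`. -/
lemma ae_frac_small :
    ∀ᵐ a ∂ν, ∀ δ : ℝ, 0 < δ → ∃ V, ∀ v ≥ V, ∀ n ≥ v, frac a v n < δ := by
  have key : ∀ j : ℕ, ∀ᵐ a ∂ν, ∃ V, ∀ v ≥ V, ∀ n ≥ v, frac a v n < 1 / ((j : ℝ) + 1) := by
    intro j
    set δ : ℝ := 1 / ((j : ℝ) + 1) with hδ
    have hδ0 : 0 < δ := by positivity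
    have hδ1 : δ ≤ 1 := by
      rw [hδ, div_le_one (by positivity)]
      linarith [(Nat.cast_nonneg j : (0 : ℝ) ≤ j)]
    have hsum : Summable fun u : ℕ =>
        2 / δ ^ 2 * (1 / (((u + 1 : ℕ) + 1 : ℝ) * ((u + 1 : ℕ) + 2))) := by
      refine Summable.mul_left _ ?_
      refine Summable.of_nonneg_of_le (fun u => by positivity) (fun u => ?_)
        ((summable_nat_add_iff 1).2 (Real.summable_one_div_nat_pow.2 one_lt_two))
      apply one_div_le_one_div_of_le (by positivity)
      push_cast
      nlinarith [(Nat.cast_nonneg u : (0 : ℝ) ≤ u)]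
    have hfin : ∑' u : ℕ, ν {a | ∃ n ≥ u + 1, δ ≤ frac a (u + 1) n} ≠ ⊤ := by
      refine ne_top_of_le_ne_top hsum.tsum_ofReal_ne_top (ENNReal.tsum_le_tsum fun u => ?_)
      exact hν.measure_exists_le_frac_le hδ0 hδ1 (Nat.le_add_left 1 u)
    filter_upwards [ae_eventually_notMem hfin] with a ha
    obtain ⟨V, hV⟩ := eventually_atTop.1 ha
    refine ⟨V + 1, fun v hv n hn => ?_⟩
    obtain ⟨w, rfl⟩ : ∃ w, v = w + 1 := ⟨v - 1, by omega⟩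
    have := hV w (by omega)
    by_contra hlt
    exact this ⟨n, hn, not_lt.1 hlt⟩
  filter_upwards [ae_all_iff.2 key] with a ha δ hδ
  obtain ⟨j, hj⟩ := exists_nat_one_div_lt hδ
  obtain ⟨V, hV⟩ := ha j
  exact ⟨V, fun v hv n hn => (hV v hv n hn).trans hj⟩

end ResamplingInvariant

/-! ### Redirecting one vertex -/

section Resample

variable {a : Attachment} {n : ℕ}

/-- The effect of redirecting vertex `n + 1` to `i` on the ancestors of `w`. -/
lemma mem_ancestors_update_iff (i : Fin (n + 1)) {c : ℕ} (hc : c ≤ n) (w : ℕ) :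
    c ∈ ancestors (Function.update a n i) w ↔
      if n + 1 ∈ ancestors a w then c ∈ ancestors a i else c ∈ ancestors a w := by
  induction w using parent_induction a with
  | zero => simp [ancestors_zero]
  | succ k ih =>
    by_cases hk : k = n
    · subst hk
      rw [mem_ancestors_succ_iff (by omega), Function.update_self, ancestors_update i i.is_le,
        if_pos (self_mem_ancestors _)]
    · simp only [ancestors_succ, Finset.mem_insert, Function.update_of_ne hk, ih,
        Nat.succ_inj, Ne.symm hk, false_or]
      by_cases hn : n + 1 ∈ ancestors a (a k)
      · have h1 := le_of_mem_ancestors hn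
        have h2 := (a k).isLt
        have h3 : c ≠ k + 1 := by omega
        simp [hn, h3]
      · simp [hn]

lemma succ_mem_ancestors_update_iff (i : Fin (n + 1)) (w : ℕ) :
    n + 1 ∈ ancestors (Function.update a n i) w ↔ n + 1 ∈ ancestors a w := by
  induction w using parent_induction a with
  | zero => simp [ancestors_zero]
  | succ k ih =>
    by_cases hk : k = n
    · subst hk
      exact iff_of_true (self_mem_ancestors _) (self_mem_ancestors _)
    · simp only [ancestors_succ, Finset.mem_insert, Function.update_of_ne hk, ih]

lemma size_update_self_succ (i : Fin (n + 1)) (m : ℕ) :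
    size (Function.update a n i) (n + 1) m = size a (n + 1) m := by
  unfold size
  simp only [succ_mem_ancestors_update_iff]

/-- The subtree of `n + 1` moves as a block: it contributes to `c` entirely or not at all, and the
remaining vertices are unaffected. -/
lemma size_update (i : Fin (n + 1)) {c : ℕ} (hc : c ≤ n) (m : ℕ) :
    size (Function.update a n i) c m =
      ((Finset.range (m + 1)).filter fun w => n + 1 ∉ ancestors a w ∧ c ∈ ancestors a w).card +
        if c ∈ ancestors a i then size a (n + 1) m else 0 := by
  unfold size
  simp only [mem_ancestors_update_iff i hc]
  split_ifs with h
  · rw [← Finset.card_union_of_disjoint]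
    · congr 1
      ext w
      simp only [Finset.mem_filter, Finset.mem_union, h]
      by_cases hw : n + 1 ∈ ancestors a w <;> simp [hw]
    · refine Finset.disjoint_filter.2 fun w _ h1 h2 => h1.1 h2
  · rw [add_zero]
    congr 1
    refine Finset.filter_congr fun w _ => ?_
    by_cases hw : n + 1 ∈ ancestors a w <;> simp [hw, h]

lemma frac_update_le {i j : Fin (n + 1)} {c : ℕ} (hc : c ≤ n) (hi : c ∈ ancestors a i) (m : ℕ) :
    frac (Function.update a n j) c m ≤ frac (Function.update a n i) c m := by
  unfold frac
  rw [size_update i hc, size_update j hc, if_pos hi]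
  gcongr
  split_ifs <;> simp

lemma frac_update_eq_add {i j : Fin (n + 1)} {c : ℕ} (hc : c ≤ n) (hi : c ∈ ancestors a i)
    (hj : c ∉ ancestors a j) (m : ℕ) :
    frac (Function.update a n i) c m =
      frac (Function.update a n j) c m + frac (Function.update a n i) (n + 1) m := by
  unfold frac
  rw [size_update i hc, size_update j hc, if_pos hi, if_neg hj, size_update_self_succ]
  push_cast
  ring

lemma rootPath_update (i : Fin (n + 1)) {v : ℕ} (hv : v ≤ n) :
    rootPath (Function.update a n i) v = rootPath a v := by
  rw [rootPath, ancestors_update i hv, rootPath]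

/-- Redirecting vertex `n + 1` from outside the descendants of `v` to a descendant of `v`
strictly decreases the limit of `pathGap`. -/
lemma not_tendsto_pathGap_update {v : ℕ} (hv1 : 1 ≤ v) (hvn : v ≤ n) {i j : Fin (n + 1)}
    (hi : v ∈ ancestors a i) (hj : v ∉ ancestors a j)
    (hLi : HasProperLimits (Function.update a n i)) (hLj : HasProperLimits (Function.update a n j))
    (hTi : Tendsto (pathGap (Function.update a n i) v) atTop (𝓝 0))
    (hTj : Tendsto (pathGap (Function.update a n j) v) atTop (𝓝 0)) : False := by
  choose! x hx0 hx1 hx using hLi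
  choose! y hy0 hy1 hy using hLj
  have hmem : ∀ c ∈ rootPath a v, 1 ≤ c ∧ c ≤ n ∧ c ∈ ancestors a i := fun c hc =>
    ⟨one_le_of_mem_rootPath a hc, (le_of_mem_rootPath a hc).trans hvn,
      ancestors_trans (Finset.mem_of_mem_erase hc) hi⟩
  have hle : ∀ c ∈ rootPath a v, y c ≤ x c := fun c hc => by
    obtain ⟨h1, h2, h3⟩ := hmem c hc
    exact le_of_tendsto_of_tendsto' (hy c h1) (hx c h1) fun m => frac_update_le h2 h3 m
  have hlt : y v < x v := by
    have h1 := (hy v hv1).add (hx (n + 1) (by omega))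
    have h2 := tendsto_nhds_unique (hx v hv1)
      (h1.congr fun m => (frac_update_eq_add hvn hi hj m).symm)
    linarith [hx0 (n + 1) (by omega)]
  have hvm := self_mem_rootPath a hv1
  have h1 : ∏ c ∈ rootPath a v, y c < ∏ c ∈ rootPath a v, x c :=
    Finset.prod_lt_prod (fun c hc => hy0 c (hmem c hc).1) hle ⟨v, hvm, hlt⟩
  have h2 : ∏ c ∈ rootPath a v, (1 - x c) < ∏ c ∈ rootPath a v, (1 - y c) :=
    Finset.prod_lt_prod (fun c hc => sub_pos.2 (hx1 c (hmem c hc).1))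
      (fun c hc => sub_le_sub_left (hle c hc) 1) ⟨v, hvm, sub_lt_sub_left hlt 1⟩
  have hX : Tendsto (pathGap (Function.update a n i) v) atTop
      (𝓝 (∏ c ∈ rootPath a v, (1 - x c) - ∏ c ∈ rootPath a v, x c)) := by
    unfold pathGap
    rw [rootPath_update i hvn]
    exact (tendsto_finsetProd _ fun c hc => (hx c (hmem c hc).1).const_sub 1).sub
      (tendsto_finsetProd _ fun c hc => hx c (hmem c hc).1)
  have hY : Tendsto (pathGap (Function.update a n j) v) atTop
      (𝓝 (∏ c ∈ rootPath a v, (1 - y c) - ∏ c ∈ rootPath a v, y c)) := by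
    unfold pathGap
    rw [rootPath_update j hvn]
    exact (tendsto_finsetProd _ fun c hc => (hy c (hmem c hc).1).const_sub 1).sub
      (tendsto_finsetProd _ fun c hc => hy c (hmem c hc).1)
  have h3 := tendsto_nhds_unique hTi hX
  have h4 := tendsto_nhds_unique hTj hY
  linarith

end Resample

/-! ### The limiting gap is almost surely nonzero -/

lemma dependsOnFirst_pathGap {v n : ℕ} (h : v ≤ n) : DependsOnFirst n fun a => pathGap a v n := by
  intro a b hab
  simp only [pathGap, frac, rootPath, ancestors_congr hab h, size_congr hab]

lemma dependsOnFirst_frac (v n : ℕ) : DependsOnFirst n fun a => frac a v n := by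
  intro a b hab
  simp only [frac, size_congr hab]

namespace ResamplingInvariant

variable {ν : Measure Attachment} (hν : ResamplingInvariant ν) [IsProbabilityMeasure ν]
include hν

lemma ae_not_tendsto_pathGap {v : ℕ} (hv : 1 ≤ v) :
    ∀ᵐ a ∂ν, ¬ Tendsto (pathGap a v) atTop (𝓝 0) := by
  classical
  obtain ⟨G, hG, hGm, hGL⟩ := hν.ae_hasProperLimits.exists_measurable_mem
  -- Intersecting with `G` gives every sequence in `E` proper limits, resampled ones included. The
  -- index `max n v` makes each term depend on finitely many attachments, hence measurable.
  set E : Set Attachment := G ∩ {a | Tendsto (fun n => pathGap a v (max n v)) atTop (𝓝 0)}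
    with hE
  have hEiff : ∀ a, a ∈ E ↔ a ∈ G ∧ Tendsto (pathGap a v) atTop (𝓝 0) := by
    intro a
    refine and_congr_right fun _ => tendsto_congr' ?_
    filter_upwards [eventually_ge_atTop v] with n hn
    rw [max_eq_left hn]
  have hEm : MeasurableSet E := hGm.inter (measurableSet_tendsto _ fun n =>
    (dependsOnFirst_pathGap (le_max_right n v)).measurable)
  set f : Attachment → ℝ := E.indicator fun _ => 1 with hf
  have hfm : Measurable f := measurable_const.indicator hEm
  have hf1 : ∀ a, |f a| ≤ 1 := fun a => by
    by_cases h : a ∈ E <;> simp [hf, h]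
  have hbound : ∀ n, v ≤ n → ∀ a, average n f a ≤ max (frac a v n) (1 - frac a v n) := by
    intro n hn a
    have hsum : ∑ i, f (Function.update a n i) =
        (Finset.univ.filter fun i => Function.update a n i ∈ E).card := by
      simp only [hf, Set.indicator_apply]
      rw [Finset.sum_boole]
    -- With the other attachments fixed, choices leading into `E` cannot occur both inside and
    -- outside the descendants of `v`; so at most the larger of the two groups counts.
    have hcase : (∀ i : Fin (n + 1), Function.update a n i ∈ E → v ∈ ancestors a i) ∨
        ∀ i : Fin (n + 1), Function.update a n i ∈ E → v ∉ ancestors a i := by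
      by_contra! h
      obtain ⟨⟨j, hjE, hj⟩, ⟨i, hiE, hi⟩⟩ := h
      rw [hEiff] at hjE hiE
      exact not_tendsto_pathGap_update hv hn hi hj (hGL _ hiE.1) (hGL _ hjE.1) hiE.2 hjE.2
    rw [average, hsum, inv_mul_eq_div]
    rcases hcase with h | h
    · refine le_max_of_le_left ?_
      rw [frac, ← card_descendants]
      gcongr with i
      exact h i
    · refine le_max_of_le_right ?_
      rw [one_sub_frac, ← card_descendants]
      have hc : n + 1 - (Finset.univ.filter fun i : Fin (n + 1) => v ∈ ancestors a i).card =
          (Finset.univ.filter fun i : Fin (n + 1) => v ∉ ancestors a i).card := by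
        rw [← Finset.compl_filter, Finset.card_compl, Fintype.card_fin]
      rw [hc]
      gcongr with i
      exact h i
  have hcond : ∀ n, ∀ᵐ a ∂ν, v ≤ n → (ν[f | past n]) a ≤ max (frac a v n) (1 - frac a v n) := by
    intro n
    by_cases hn : v ≤ n
    · have hd : DependsOnFirst n fun a => max (frac a v n) (1 - frac a v n) := fun a b hab => by
        simp only [dependsOnFirst_frac v n hab]
      obtain ⟨C, hC⟩ := hd.exists_abs_le
      have h1 := condExp_mono (m := past n) (μ := ν)
        (integrable_of_abs_le (measurable_average hfm n) (abs_average_le hf1 n))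
        (integrable_of_abs_le hd.measurable hC) (ae_of_all _ (hbound n hn))
      rw [condExp_of_stronglyMeasurable (past.le n) hd.measurable_past.stronglyMeasurable
        (integrable_of_abs_le hd.measurable hC)] at h1
      filter_upwards [h1, hν.condExp_average hfm hf1 n] with a h2 h3 _
      rwa [← h3]
    · exact ae_of_all _ fun a h => absurd h hn
  have hlevy := tendsto_ae_condExp (μ := ν) (ℱ := past) f
  rw [iSup_past, condExp_of_stronglyMeasurable le_rfl hfm.stronglyMeasurable
    (integrable_of_abs_le hfm hf1)] at hlevy
  filter_upwards [hG, hlevy, ae_all_iff.2 hcond] with a haG h1 h2 hT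
  have haE : a ∈ E := (hEiff a).2 ⟨haG, hT⟩
  obtain ⟨x, hx0, hx1, hx⟩ := hGL a haG v hv
  have h3 : f a ≤ max x (1 - x) := le_of_tendsto_of_tendsto h1 (hx.max (hx.const_sub 1))
    ((eventually_ge_atTop v).mono fun n hn => h2 n hn)
  simp only [hf, Set.indicator_of_mem haE] at h3
  exact absurd h3 (not_le.2 (max_lt hx1 (by linarith)))

lemma ae_eventually_rank_eq : ∀ᵐ a ∂ν, ∃ K, ∀ᶠ n in atTop,
    rank (rumorCentrality (recursiveTree a n)) 0 = K := by
  have h : ∀ᵐ a ∂ν, ∀ v, 1 ≤ v → ¬ Tendsto (pathGap a v) atTop (𝓝 0) := by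
    refine ae_all_iff.2 fun v => ?_
    by_cases hv : 1 ≤ v
    · exact (hν.ae_not_tendsto_pathGap hv).mono fun _ h _ => h
    · exact ae_of_all _ fun _ h => absurd h hv
  filter_upwards [hν.ae_hasProperLimits, hν.ae_frac_small, h] with a h1 h2 h3
  exact h1.eventually_rank_eq h2 h3

end ResamplingInvariant

/-! ### Measurability and persistence -/

lemma measurable_rootRank {Ω : Type*} [MeasurableSpace Ω] {U : ∀ n : ℕ, Ω → Fin (n + 1)}
    (hU : ∀ n, Measurable (U n)) (n : ℕ) : Measurable (rootRank U n) := by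
  have hd : DependsOnFirst n fun a : Attachment =>
      rank (rumorCentrality (recursiveTree a n)) 0 := by
    intro a b hab
    simp only [recursiveTree_congr hab]
  exact hd.measurable.comp (measurable_pi_lambda (fun ω n => U n ω) hU)

/-- An almost surely eventually constant sequence of random variables is persistent. -/
lemma persistent_of_ae_eventually_eq {Ω : Type*} [MeasurableSpace Ω] {μ : Measure Ω}
    [IsProbabilityMeasure μ] {R : ℕ → Ω → ℕ} (hR : ∀ n, Measurable (R n))
    (h : ∀ᵐ ω ∂μ, ∃ K, ∀ᶠ n in atTop, R n ω = K) : Persistent μ R := by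
  classical
  -- The σ-algebra on `ℕ∞` contains all sets; it is Borel because every subset is countable.
  have hborel : BorelSpace ℕ∞ := ⟨by
    refine le_antisymm ?_ le_top
    let : MeasurableSpace ℕ∞ := borel ℕ∞
    have : BorelSpace ℕ∞ := ⟨rfl⟩
    exact fun s _ => (Set.to_countable s).measurableSet⟩
  set N : Ω → ℕ∞ := fun ω => ⨅ n : ℕ, if ∀ m ≥ n, R m ω = R n ω then (n : ℕ∞) else ⊤ with hN
  set K : Ω → ℕ∞ := fun ω => limsup (fun n => (R n ω : ℕ∞)) atTop with hK
  have hKeq : ∀ ω n, (∀ m ≥ n, R m ω = R n ω) → K ω = R n ω := by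
    intro ω n hn
    have : (fun m => (R m ω : ℕ∞)) =ᶠ[atTop] fun _ => (R n ω : ℕ∞) := by
      filter_upwards [eventually_ge_atTop n] with m hm
      rw [hn m hm]
    simp only [hK]
    rw [limsup_congr this, limsup_const]
  have hone : ∀ p : Ω → Prop, (∀ᵐ ω ∂μ, p ω) → μ {ω | p ω} = 1 := fun p hp => by
    rw [measure_congr (t := Set.univ) (eventuallyEq_univ.2 hp), measure_univ]
  have hstable : ∀ᵐ ω ∂μ, ∃ n, ∀ m ≥ n, R m ω = R n ω := by
    filter_upwards [h] with ω ⟨k, hk⟩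
    obtain ⟨n, hn⟩ := eventually_atTop.1 hk
    exact ⟨n, fun m hm => (hn m hm).trans (hn n le_rfl).symm⟩
  refine ⟨N, K, ?_, ?_, hone _ ?_, hone _ ?_, ?_⟩
  · refine Measurable.iInf fun n => Measurable.ite ?_ measurable_const measurable_const
    simp only [Set.ofPred_forall]
    exact MeasurableSet.iInter fun m => MeasurableSet.iInter fun _ =>
      measurableSet_eq_fun (hR m) (hR n)
  · exact Measurable.limsup fun n => (measurable_of_countable _).comp (hR n)
  · filter_upwards [hstable] with ω ⟨n, hn⟩
    refine (iInf_le _ n).trans_lt ?_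
    rw [if_pos hn]
    exact ENat.natCast_lt_top n
  · filter_upwards [hstable] with ω ⟨n, hn⟩
    rw [hKeq ω n hn]
    exact ENat.natCast_lt_top _
  · intro ω n hn
    have hlt : N ω < (n + 1 : ℕ) := hn.trans_lt (by exact_mod_cast Nat.lt_succ_self n)
    obtain ⟨k, hk⟩ := iInf_lt_iff.1 hlt
    split_ifs at hk with hs
    · have hkn : k ≤ n := Nat.lt_succ_iff.1 (by exact_mod_cast hk)
      rw [hKeq ω k hs, hs n hkn]
    · exact absurd hk (not_lt.2 le_top)

end RumorRank

theorem mainTheorem9 {Ω : Type*} [MeasurableSpace Ω] (μ : Measure Ω) [IsProbabilityMeasure μ]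
    (U : ∀ n : ℕ, Ω → Fin (n + 1)) (hU : RumorRank.IsUniformAttachment μ U) :
    RumorRank.Persistent μ (RumorRank.rootRank U) := by
  have hm : Measurable fun ω n => U n ω := measurable_pi_lambda _ hU.measurable
  have : IsProbabilityMeasure (μ.map fun ω n => U n ω) :=
    Measure.isProbabilityMeasure_map hm.aemeasurable
  exact RumorRank.persistent_of_ae_eventually_eq (RumorRank.measurable_rootRank hU.measurable)
    (ae_of_ae_map hm.aemeasurable hU.resamplingInvariant.ae_eventually_rank_eq)
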